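/- Let $p$ be an odd prime, $d\ge 1$, $q=p^d$, and let $\alpha$ be a primitive element of $\mathbb{F}_q$. For $k\in\{0,1\}$ let $D_k=\{\alpha^{2i+k}-1 : 0\le i<(q-1)/2\}$. The SLCE sequence is $s_j=0$ if $\alpha^j=-1$ and $s_j=k$ if $\alpha^j\in D_k$ ($0\le j<q-1$), and the SLCE almost difference set is $S=\{j\in\mathbb{Z}/(q-1)\mathbb{Z} : s_j=1\}$. Write $G$ for the cyclic group $\mathbb{Z}/(q-1)\mathbb{Z}$, written multiplicatively, and $r'$ for the least positive integer in a residue class $r$ modulo $q-1$. A unit $t\in(\mathbb{Z}/(q-1)\mathbb{Z})^*$ is a multiplier of $S$ if, in the group ring $\mathbb{Z}[G]$, there is $g\in G$ with $\sum_{s\in S}s^{t'}=g\sum_{s\in S}s$. Let $T$ be a complete set of distinct coset representatives of the subgroup $\langle p\rangle$ in $(\mathbb{Z}/(q-1)\mathbb{Z})^*$, and let $t\in T$ be a multiplier of $S$. Put $$S_0=\Bigl\{j\in T : d-\sum_{i=0}^{d-1}\Bigl(\Bigl\lfloor\frac{2(j^{-1})'p^i}{q-1}\Bigr\rfloor-2\Bigl\lfloor\frac{(j^{-1})'p^i}{q-1}\Bigr\rfloor\Bigr)>0\Bigr\},\qquad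 tS_0=\{tj : j\in S_0\}.$$ Then the sets $S_0$ and $tS_0$ are either identical or disjoint. Moreover, the same holds modulo $\langle p\rangle$: the set of cosets $\{j\langle p\rangle : j\in S_0\}$ and the set of cosets $\{tj\langle p\rangle : j\in S_0\}$ are either identical or disjoint. -/

import Mathlib

open scoped Pointwise

noncomputable section

namespace SLCE

/-- The class `D_k = {α^(M i + k) - 1 | 0 ≤ i < (q-1)/M}`, where `q` is the number of elements
of the finite field `F`. -/
def sidelnikovClass {F : Type*} [Field F] (α : Fˣ) (M k : ℕ) : Set F :=
  {x | ∃ i : ℕ, i < (Nat.card F - 1) / M ∧ x = (α : F) ^ (M * i + k) - 1}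

open Classical in
/-- The binary Sidelnikov (SLCE) sequence for the primitive element `α`: `s_j = 0` if
`α^j = -1`, and otherwise `s_j` is the `k ∈ {0, 1}` with `α^j ∈ D_k`. -/
def slceSeq {F : Type*} [Field F] (α : Fˣ) (j : ℕ) : ZMod 2 :=
  if (α : F) ^ j = -1 then 0
  else if (α : F) ^ j ∈ sidelnikovClass α 2 1 then 1
  else 0

/-- The set of residues modulo `v` with which a binary sequence is associated: the classes of
those `i ∈ {0, …, v-1}` for which `a_i = 1`. -/
def residueSet (v : ℕ) (a : ℕ → ZMod 2) : Finset (ZMod v) :=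
  ((Finset.range v).filter fun i => a i = 1).image fun i : ℕ => (i : ZMod v)

/-- The SLCE almost difference set: the set of residues modulo `q - 1` associated with the SLCE
sequence for `α`. -/
def slceSet (v : ℕ) {F : Type*} [Field F] (α : Fˣ) : Finset (ZMod v) :=
  residueSet v (slceSeq α)

/-- The sum of the elements of `A` in the integral group ring of `G = ℤ/vℤ`. -/
def groupRingSum {v : ℕ} (A : Finset (ZMod v)) : AddMonoidAlgebra ℤ (ZMod v) :=
  ∑ g ∈ A, AddMonoidAlgebra.single g 1

/-- The least positive integer `r'` in the residue class `r` modulo `n` (for `n > 0`). -/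
def leastPos {n : ℕ} (r : ZMod n) : ℕ := if r.val = 0 then n else r.val

theorem isLeast_leastPos {n : ℕ} (hn : 0 < n) (r : ZMod n) :
    IsLeast {m : ℕ | 0 < m ∧ (m : ZMod n) = r} (leastPos r) := by
  haveI : NeZero n := ⟨hn.ne'⟩
  unfold leastPos
  split_ifs with h
  · have hr : r = 0 := (ZMod.val_eq_zero r).1 h
    refine ⟨⟨hn, by simp [hr]⟩, ?_⟩
    rintro m ⟨hm, hmr⟩
    rw [hr, ZMod.natCast_eq_zero_iff] at hmr
    exact Nat.le_of_dvd hm hmr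
  · refine ⟨⟨Nat.pos_of_ne_zero h, by simp⟩, ?_⟩
    rintro m ⟨-, hmr⟩
    rw [← hmr, ZMod.val_natCast]
    exact Nat.mod_le m n

/-- For `A = ∑ a_g g` in the group ring of `G = ℤ/vℤ`, the element `A^(t) = ∑ a_g g^(t')`
(the power `g^(t')` of the group element `g` is the multiple `t' • g` in additive notation). -/
def powMap {v : ℕ} (t : (ZMod v)ˣ) (A : AddMonoidAlgebra ℤ (ZMod v)) :
    AddMonoidAlgebra ℤ (ZMod v) :=
  AddMonoidAlgebra.mapDomain (fun g : ZMod v => leastPos (t : ZMod v) • g) A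

/-- `t` is a multiplier of `A` if `A^(t) = g A` for some group element `g`. -/
def IsMultiplier {v : ℕ} (t : (ZMod v)ˣ) (A : AddMonoidAlgebra ℤ (ZMod v)) : Prop :=
  ∃ g : ZMod v, powMap t A = AddMonoidAlgebra.single g 1 * A

/-- The subgroup `⟨p⟩` of `(ℤ/vℤ)ˣ` generated by the class of `p`. -/
def genSubgroup (v p : ℕ) : Subgroup (ZMod v)ˣ :=
  Subgroup.closure {u | (u : ZMod v) = (p : ZMod v)}

theorem genSubgroup_eq_zpowers {v p : ℕ} (h : p.Coprime v) :
    genSubgroup v p = Subgroup.zpowers (ZMod.unitOfCoprime p h) := by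
  unfold genSubgroup
  rw [Subgroup.zpowers_eq_closure]
  congr 1
  ext u
  simp [Units.ext_iff]

/-- The exponent
`d - ∑_{i=0}^{d-1} (⌊2 x' p^i / (q-1)⌋ - 2 ⌊x' p^i / (q-1)⌋)`, where `q = p^d`. -/
def stickExp (p d : ℕ) (x : (ZMod (p ^ d - 1))ˣ) : ℤ :=
  (d : ℤ) - ∑ i ∈ Finset.range d,
    (⌊(2 * (leastPos (x : ZMod (p ^ d - 1)) : ℚ) * (p : ℚ) ^ i) / ((p : ℚ) ^ d - 1)⌋
      - 2 * ⌊((leastPos (x : ZMod (p ^ d - 1)) : ℚ) * (p : ℚ) ^ i) / ((p : ℚ) ^ d - 1)⌋)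

/-- The set `S_0` of those `j ∈ T` for which the exponent at `j⁻¹` is positive. -/
def S0 (p d : ℕ) (T : Set (ZMod (p ^ d - 1))ˣ) : Set (ZMod (p ^ d - 1))ˣ :=
  {j | j ∈ T ∧ 0 < stickExp p d j⁻¹}

/-- The set of cosets of `⟨p⟩` in `(ℤ/vℤ)ˣ` that are represented by elements of `A`. -/
def cosets {v : ℕ} (p : ℕ) (A : Set (ZMod v)ˣ) : Set ((ZMod v)ˣ ⧸ genSubgroup v p) :=
  (fun j : (ZMod v)ˣ => (j : (ZMod v)ˣ ⧸ genSubgroup v p)) '' A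

end SLCE

end

/-! Evaluate the characters `x ↦ α ^ (a x)` of `ℤ/(q-1)ℤ`, with values in `𝔽_q` itself, on `S`. With
`m = (q-1)/2` and `a ≠ 0`, twice the sum is `C(m, -a) - α ^ (a m)` (`two_mul_charSum_slceSet`). By
Lucas, since every base `p` digit of `m` is `(p-1)/2`, the binomial is nonzero in `𝔽_q` exactly when
all digits of `-a` are at most `(p-1)/2` (`choose_half_ne_zero_iff`). At a unit `a` with positive
exponent it vanishes (`not_smallDigits_neg_of_stickExp_pos`), and twice the sum is `1`.

A multiplier `t` with translation `g` gives `χ_{at}(S) = α ^ (a g) χ_a(S)`. If `S_0` and `t S_0`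
share a coset of `⟨p⟩`, some unit `a` has twice the sum equal to `1` at both `a` and `a t`, which
forces `g = 0`. Then `t` preserves the residues with small digits, and only powers of `p` do so
(`exists_eq_pow_of_smallDigits_mul`). So either the coset sets are disjoint or `t ∈ ⟨p⟩`, where
everything is immediate. -/

namespace SLCE

/-! ### Base `p` digits of residues modulo `p ^ d - 1` -/

section Digits

variable {p d : ℕ}

theorem sum_digits_lt_and_digit_eq (f : Fin d → ℕ) (hf : ∀ i, f i < p) :
    (∑ i, f i * p ^ (i : ℕ)) < p ^ d ∧
      ∀ i : Fin d, (∑ i, f i * p ^ (i : ℕ)) / p ^ (i : ℕ) % p = f i := by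
  let F : Fin d → Fin p := fun i => ⟨f i, hf i⟩
  have hF : ((finFunctionFinEquiv F : Fin (p ^ d)) : ℕ) = ∑ i, f i * p ^ (i : ℕ) :=
    finFunctionFinEquiv_apply F
  refine ⟨hF ▸ (finFunctionFinEquiv F).isLt, fun i => ?_⟩
  have h := congrArg Fin.val (congrFun (finFunctionFinEquiv.symm_apply_apply F) i)
  rw [← hF]
  exact h

theorem sum_digit_mul_pow {e : ℕ} (he : e < p ^ d) :
    ∑ i : Fin d, e / p ^ (i : ℕ) % p * p ^ (i : ℕ) = e := by
  have h := congrArg Fin.val (finFunctionFinEquiv.apply_symm_apply (⟨e, he⟩ : Fin (p ^ d)))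
  rw [finFunctionFinEquiv_apply] at h
  exact h

theorem natCast_pow_eq_one (hp : 0 < p) : (p : ZMod (p ^ d - 1)) ^ d = 1 := by
  have h : ((p ^ d - 1 : ℕ) : ZMod (p ^ d - 1)) = 0 := ZMod.natCast_self _
  rw [Nat.cast_sub (Nat.one_le_pow _ _ hp)] at h
  push_cast at h
  exact sub_eq_zero.1 h

theorem natCast_pow_mod (hp : 0 < p) (k : ℕ) :
    (p : ZMod (p ^ d - 1)) ^ (k % d) = (p : ZMod (p ^ d - 1)) ^ k := by
  conv_rhs => rw [← Nat.div_add_mod k d, pow_add, pow_mul, natCast_pow_eq_one hp, one_pow, one_mul]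

/-- A nonzero residue modulo `p ^ d - 1` is determined by any base `p` expansion of length `d`. -/
theorem val_eq_sum_digits {e : ZMod (p ^ d - 1)} (he : e ≠ 0) (f : Fin d → ℕ)
    (hf : ∀ i, f i < p) (hef : e = ∑ i, (f i : ZMod (p ^ d - 1)) * (p : ZMod (p ^ d - 1)) ^ (i : ℕ)) :
    e.val = ∑ i, f i * p ^ (i : ℕ) := by
  have h1 : e = ((∑ i, f i * p ^ (i : ℕ) : ℕ) : ZMod (p ^ d - 1)) := by
    rw [hef]; push_cast; rfl
  have h2 := (sum_digits_lt_and_digit_eq f hf).1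
  -- The only ambiguity is `0`, also represented by the expansion with all digits `p - 1`.
  have h3 : (∑ i, f i * p ^ (i : ℕ)) ≠ p ^ d - 1 := by
    intro h
    rw [h, ZMod.natCast_self] at h1
    exact he h1
  rw [h1, ZMod.val_natCast, Nat.mod_eq_of_lt (by omega)]

/-- All base `p` digits of the residue `e` modulo `p ^ d - 1` are at most `p / 2`. -/
def SmallDigits (p d : ℕ) (e : ZMod (p ^ d - 1)) : Prop :=
  ∀ i : Fin d, e.val / p ^ (i : ℕ) % p ≤ p / 2

theorem smallDigits_iff {e : ZMod (p ^ d - 1)} (he : e ≠ 0) (f : Fin d → ℕ)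
    (hf : ∀ i, f i < p) (hef : e = ∑ i, (f i : ZMod (p ^ d - 1)) * (p : ZMod (p ^ d - 1)) ^ (i : ℕ)) :
    SmallDigits p d e ↔ ∀ i, f i ≤ p / 2 := by
  unfold SmallDigits
  rw [val_eq_sum_digits he f hf hef]
  simp only [(sum_digits_lt_and_digit_eq f hf).2]

theorem neZero_pow_sub_one (hp : 1 < p) (hd : 0 < d) : NeZero (p ^ d - 1) :=
  ⟨by have := Nat.one_lt_pow hd.ne' hp; omega⟩

theorem eq_sum_digits (hp : 1 < p) (hd : 0 < d) (e : ZMod (p ^ d - 1)) :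
    e = ∑ i : Fin d, ((e.val / p ^ (i : ℕ) % p : ℕ) : ZMod (p ^ d - 1)) *
      (p : ZMod (p ^ d - 1)) ^ (i : ℕ) := by
  have := neZero_pow_sub_one hp hd
  have h := sum_digit_mul_pow (p := p) (d := d) (e := e.val)
    (by have := e.val_lt; omega)
  conv_lhs => rw [← ZMod.natCast_zmod_val e, ← h]
  push_cast
  rfl

/-- Multiplication by `p ^ j` rotates base `p` expansions modulo `p ^ d - 1`. -/
theorem pow_mul_sum_digits [NeZero d] (hp : 0 < p) (f : Fin d → ℕ) (j : Fin d) :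
    (p : ZMod (p ^ d - 1)) ^ (j : ℕ) *
        ∑ i, (f i : ZMod (p ^ d - 1)) * (p : ZMod (p ^ d - 1)) ^ (i : ℕ) =
      ∑ i, (f (i - j) : ZMod (p ^ d - 1)) * (p : ZMod (p ^ d - 1)) ^ (i : ℕ) := by
  rw [← Equiv.sum_comp (Equiv.addRight j)
    (fun i => (f (i - j) : ZMod (p ^ d - 1)) * (p : ZMod (p ^ d - 1)) ^ (i : ℕ)), Finset.mul_sum]
  refine Finset.sum_congr rfl fun i _ => ?_
  simp only [Equiv.coe_addRight, add_sub_cancel_right, Fin.val_add]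
  rw [natCast_pow_mod hp, pow_add]
  ring

theorem smallDigits_zero : SmallDigits p d 0 := by
  intro i; simp

theorem SmallDigits.pow_mul (hp : 1 < p) (hd : 0 < d) {e : ZMod (p ^ d - 1)}
    (he : SmallDigits p d e) (k : ℕ) : SmallDigits p d ((p : ZMod (p ^ d - 1)) ^ k * e) := by
  have : NeZero d := ⟨hd.ne'⟩
  by_cases h0 : (p : ZMod (p ^ d - 1)) ^ k * e = 0
  · rw [h0]; exact smallDigits_zero
  rw [← natCast_pow_mod (by omega)] at h0 ⊢
  have h := pow_mul_sum_digits (p := p) (by omega) (fun i => e.val / p ^ (i : ℕ) % p)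
    ⟨k % d, Nat.mod_lt _ hd⟩
  rw [← eq_sum_digits hp hd e] at h
  exact (smallDigits_iff h0 _ (fun i => Nat.mod_lt _ (by omega)) h).2 fun i => he _

theorem sum_half_mul_pow (hodd : Odd p) :
    ∑ i : Fin d, p / 2 * p ^ (i : ℕ) = (p ^ d - 1) / 2 := by
  obtain ⟨h, rfl⟩ := hodd
  have h1 := geom_sum_mul_of_one_le (x := 2 * h + 1) (by omega) d
  rw [← Finset.mul_sum, Fin.sum_univ_eq_sum_range (fun i => (2 * h + 1) ^ i), ← h1,
    Nat.add_sub_cancel, show (2 * h + 1) / 2 = h by omega, mul_comm, ← mul_assoc, mul_right_comm,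
    Nat.mul_div_cancel _ two_pos]

theorem SmallDigits.val_le (hp : 1 < p) (hodd : Odd p) (hd : 0 < d)
    {e : ZMod (p ^ d - 1)} (he : SmallDigits p d e) : e.val ≤ (p ^ d - 1) / 2 := by
  have := neZero_pow_sub_one hp hd
  rw [← sum_half_mul_pow hodd,
    ← sum_digit_mul_pow (p := p) (d := d) (e := e.val) (by have := e.val_lt; omega)]
  exact Finset.sum_le_sum fun i _ => Nat.mul_le_mul_right _ (he i)

/-- A unit of `ℤ/(p ^ d - 1)ℤ` preserving the residues with small digits is a power of `p`. -/
theorem exists_eq_pow_of_smallDigits_mul (hp : 1 < p) (hodd : Odd p) (hd : 0 < d)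
    (t : (ZMod (p ^ d - 1))ˣ)
    (ht : ∀ e : ZMod (p ^ d - 1), SmallDigits p d e → SmallDigits p d (t * e)) :
    ∃ k : ℕ, (t : ZMod (p ^ d - 1)) = (p : ZMod (p ^ d - 1)) ^ k := by
  have hnz := neZero_pow_sub_one hp hd
  have : NeZero d := ⟨hd.ne'⟩
  have hp3 : 3 ≤ p := by obtain ⟨h, rfl⟩ := hodd; omega
  have hpd : p ≤ p ^ d := Nat.le_self_pow hd.ne' p
  have : Fact (1 < p ^ d - 1) := ⟨by omega⟩
  have hp0 : 0 < p := by omega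
  set T : Fin d → ℕ := fun i => (t : ZMod (p ^ d - 1)).val / p ^ (i : ℕ) % p with hT
  have hTt : (t : ZMod (p ^ d - 1)) = ∑ i, (T i : ZMod (p ^ d - 1)) *
      (p : ZMod (p ^ d - 1)) ^ (i : ℕ) := eq_sum_digits hp hd _
  have hone : (1 : ZMod (p ^ d - 1)) = ∑ i : Fin d, (((if i = 0 then 1 else 0) : ℕ) :
      ZMod (p ^ d - 1)) * (p : ZMod (p ^ d - 1)) ^ (i : ℕ) := by
    rw [Finset.sum_eq_single 0] <;> simp +contextual
  have hsmall : ∀ k : ℕ, 0 < k → k ≤ p / 2 → SmallDigits p d (k : ZMod (p ^ d - 1)) ∧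
      (k : ZMod (p ^ d - 1)) ≠ 0 := by
    intro k hk0 hk
    have hne : (k : ZMod (p ^ d - 1)) ≠ 0 := by
      rw [Ne, ZMod.natCast_eq_zero_iff]
      intro h
      have := Nat.le_of_dvd hk0 h
      omega
    refine ⟨(smallDigits_iff hne (fun i => k * if i = 0 then 1 else 0) ?_ ?_).2 ?_, hne⟩
    · intro i; split_ifs <;> omega
    · conv_lhs => rw [← mul_one (k : ZMod (p ^ d - 1)), hone, Finset.mul_sum]
      refine Finset.sum_congr rfl fun i _ => ?_
      push_cast; ring
    · intro i; split_ifs <;> omega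
  -- Induction on `k` rules out carries: `k * T i` and `T i` are at most `p / 2`, so `(k + 1) * T i
  -- < p` is a genuine digit of `t * (k + 1)`.
  have hmul : ∀ k : ℕ, k ≤ p / 2 → ∀ i, k * T i ≤ p / 2 := by
    intro k
    induction k with
    | zero => intro _ i; simp
    | succ k ih =>
      intro hk i
      obtain ⟨h1, h2⟩ := hsmall (k + 1) (by omega) hk
      have hT1 : ∀ i, T i ≤ p / 2 := by
        have := ht 1 (by simpa using (hsmall 1 one_pos (by omega)).1)
        rw [mul_one] at this
        exact this
      refine (smallDigits_iff (e := (t : ZMod (p ^ d - 1)) * ((k + 1 : ℕ) : ZMod (p ^ d - 1)))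
        (by simpa using h2) (fun i => (k + 1) * T i) ?_ ?_).1 (ht _ h1) i
      · intro i
        have := ih (by omega) i
        have := hT1 i
        rw [add_mul, one_mul]
        obtain ⟨h, rfl⟩ := hodd
        omega
      · conv_lhs => rw [hTt, Finset.sum_mul]
        refine Finset.sum_congr rfl fun i _ => ?_
        push_cast; ring
  have hT01 : ∀ i, T i ≤ 1 := by
    intro i
    have h := hmul (p / 2) le_rfl i
    by_contra hc
    have := Nat.mul_le_mul_left (p / 2) (show 2 ≤ T i by omega)
    omega
  have htne : (t : ZMod (p ^ d - 1)) ≠ 0 := t.ne_zero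
  have hex : ∃ i, T i = 1 := by
    by_contra! hc
    apply htne
    rw [hTt]
    refine Finset.sum_eq_zero fun i _ => ?_
    have := hT01 i
    have := hc i
    rw [show T i = 0 by omega]; simp
  obtain ⟨a, ha⟩ := hex
  by_cases huniq : ∀ b, T b = 1 → b = a
  · refine ⟨a, ?_⟩
    rw [hTt, Finset.sum_eq_single a]
    · simp [ha]
    · intro b _ hb
      have := hT01 b
      have : T b ≠ 1 := fun h => hb (huniq b h)
      rw [show T b = 0 by omega]; simp
    · simp
  exfalso
  push Not at huniq
  obtain ⟨b, hb, hba⟩ := huniq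
  set j : Fin d := b - a with hj
  have hj0 : j ≠ 0 := sub_ne_zero.2 hba
  -- If `t` has digit `1` at both `a` and `b`, the shift by `j = b - a` aligns them, so `t * e` has
  -- digit `2 * (p / 2) = p - 1` at `b`, which is too large.
  let e : ZMod (p ^ d - 1) := ((p / 2 : ℕ) : ZMod (p ^ d - 1)) * (1 + (p : ZMod (p ^ d - 1)) ^ (j : ℕ))
  let f : Fin d → ℕ := fun i => p / 2 * (if i = 0 then 1 else 0) +
    p / 2 * (if i - j = 0 then 1 else 0)
  have hef : e = ∑ i, (f i : ZMod (p ^ d - 1)) * (p : ZMod (p ^ d - 1)) ^ (i : ℕ) := by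
    have h := pow_mul_sum_digits (p := p) (by omega) (fun i : Fin d => if i = 0 then 1 else 0) j
    rw [← hone, mul_one] at h
    simp only [e, f, Nat.cast_add, Nat.cast_mul, add_mul, Finset.sum_add_distrib, mul_assoc,
      ← Finset.mul_sum]
    rw [mul_add, mul_one, h, ← hone, mul_one]
  have hfle : ∀ i, f i ≤ p / 2 := by
    intro i
    simp only [f]
    by_cases hi : i = 0
    · have : ¬ (i - j = 0) := by rw [hi, zero_sub, neg_eq_zero]; exact hj0
      rw [if_neg this, if_pos hi]; omega
    · rw [if_neg hi]; split_ifs <;> omega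
  have hflt : ∀ i, f i < p := fun i => by have := hfle i; omega
  have hene : e ≠ 0 := by
    intro h0
    have h1 : (∑ i, f i * p ^ (i : ℕ)) ≠ 0 := by
      have : f 0 * p ^ ((0 : Fin d) : ℕ) ≤ ∑ i, f i * p ^ (i : ℕ) :=
        Finset.single_le_sum (f := fun i : Fin d => f i * p ^ (i : ℕ)) (fun i _ => Nat.zero_le _)
          (Finset.mem_univ 0)
      have h2 : p / 2 ≤ f 0 := by simp [f]
      simp only [Fin.val_zero, pow_zero, mul_one] at this
      omega
    have h3 : ((∑ i, f i * p ^ (i : ℕ) : ℕ) : ZMod (p ^ d - 1)) = 0 := by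
      rw [← h0, hef]; push_cast; rfl
    rw [ZMod.natCast_eq_zero_iff] at h3
    have h4 := (sum_digits_lt_and_digit_eq f hflt).1
    have h5 := Nat.le_of_dvd (Nat.pos_of_ne_zero h1) h3
    have h6 : (∑ i, f i * p ^ (i : ℕ)) < p ^ d - 1 := by
      have h7 : (∑ i, f i * p ^ (i : ℕ)) < ∑ i : Fin d, (p - 1) * p ^ (i : ℕ) := by
        refine Finset.sum_lt_sum (fun i _ => Nat.mul_le_mul_right _ ?_) ⟨0, Finset.mem_univ _, ?_⟩
        · have := hflt i; omega
        · refine Nat.mul_lt_mul_of_pos_right ?_ (by positivity)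
          have := hfle 0
          omega
      have h8 := (sum_digits_lt_and_digit_eq (p := p) (fun _ : Fin d => p - 1)
        (fun _ => by omega)).1
      omega
    omega
  have hKe : SmallDigits p d e := (smallDigits_iff hene f hflt hef).2 hfle
  have hte : (t : ZMod (p ^ d - 1)) * e = ∑ i, ((p / 2 * T i + p / 2 * T (i - j) : ℕ) :
      ZMod (p ^ d - 1)) * (p : ZMod (p ^ d - 1)) ^ (i : ℕ) := by
    have h := pow_mul_sum_digits (p := p) (by omega) T j
    rw [← hTt] at h
    simp only [Nat.cast_add, Nat.cast_mul, add_mul, Finset.sum_add_distrib, mul_assoc,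
      ← Finset.mul_sum]
    rw [← h, ← hTt]
    simp only [e]
    ring
  have h9 := (smallDigits_iff (by simpa using hene) _ ?_ hte).1 (ht e hKe) b
  · rw [hb, hj, sub_sub_cancel, ha] at h9
    omega
  -- Still no carry: the digits are at most `2 * (p / 2) = p - 1`.
  · intro i
    have h1 := Nat.mul_le_mul_left (p / 2) (hT01 i)
    have h2 := Nat.mul_le_mul_left (p / 2) (hT01 (i - j))
    obtain ⟨h, rfl⟩ := hodd
    omega

end Digits

/-! ### Lucas' theorem for the middle binomials -/

section Binomial

variable {p d : ℕ}

theorem choose_half_ne_zero_iff (hp : p.Prime) (hodd : Odd p) (hd : 0 < d)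
    (R : Type*) [AddMonoidWithOne R] [CharP R p] (e : ZMod (p ^ d - 1)) :
    (((p ^ d - 1) / 2).choose e.val : R) ≠ 0 ↔ SmallDigits p d e := by
  have := neZero_pow_sub_one hp.one_lt hd
  have hdig := (sum_digits_lt_and_digit_eq (p := p) (d := d) (fun _ => p / 2)
    (fun _ => Nat.div_lt_self hp.pos one_lt_two)).2
  rw [sum_half_mul_pow hodd] at hdig
  have : Fact p.Prime := ⟨hp⟩
  have hlucas := Choose.choose_modEq_prod_range_choose_nat (n := (p ^ d - 1) / 2) (k := e.val)
    (p := p) (a := d) (by have := Nat.one_le_pow d p hp.pos; omega)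
    (by have := e.val_lt; omega)
  rw [Ne, CharP.cast_eq_zero_iff R p, hlucas.dvd_iff dvd_rfl,
    hp.prime.dvd_finsetProd_iff]
  simp only [Finset.mem_range, not_exists, not_and]
  constructor
  · intro h i
    by_contra hc
    refine h i i.isLt ?_
    rw [hdig i, Nat.choose_eq_zero_of_lt (by omega)]
    exact dvd_zero p
  · intro h i hi hdvd
    have h1 := hdig ⟨i, hi⟩
    have h2 := h ⟨i, hi⟩
    simp only at h1 h2
    rw [h1] at hdvd
    have h3 : p / 2 < p := Nat.div_lt_self hp.pos one_lt_two
    have h4 : p ∣ (p / 2).factorial := by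
      rw [← Nat.choose_mul_factorial_mul_factorial h2, mul_assoc]
      exact hdvd.mul_right _
    exact absurd (hp.dvd_factorial.1 h4) (by omega)

end Binomial

/-! ### Positive exponents and digits -/

section Exponent

variable {p d : ℕ}

theorem two_mul_floor_add_one_le {N n : ℕ} (hn : 0 < n) (h : n ≤ 2 * (N % n)) :
    2 * ⌊(N : ℚ) / n⌋ + 1 ≤ ⌊2 * ((N : ℚ) / n)⌋ := by
  have hn' : (0 : ℚ) < n := by exact_mod_cast hn
  have hN : (N : ℚ) / n = (N / n : ℕ) + ((N % n : ℕ) : ℚ) / n := by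
    rw [eq_comm, eq_div_iff hn'.ne', add_mul, div_mul_cancel₀ _ hn'.ne']
    exact_mod_cast Nat.div_add_mod' N n
  have hr : (1 : ℚ) ≤ 2 * (((N % n : ℕ) : ℚ) / n) := by
    rw [← mul_div_assoc, le_div_iff₀ hn', one_mul]
    exact_mod_cast h
  have hr1 : ((N % n : ℕ) : ℚ) / n < 1 := by
    rw [div_lt_one hn']
    exact_mod_cast Nat.mod_lt N hn
  have hf : ⌊(N : ℚ) / n⌋ = ((N / n : ℕ) : ℤ) := by
    rw [Int.floor_eq_iff, hN, Int.cast_natCast]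
    have : (0 : ℚ) ≤ ((N % n : ℕ) : ℚ) / n := by positivity
    constructor <;> linarith
  rw [hf, Int.le_floor, hN]
  simp only [Int.cast_add, Int.cast_mul, Int.cast_natCast, Int.cast_ofNat, Int.cast_one]
  linarith

/-- If `-c` had small digits, so would each rotation `-p ^ i c`, which is then at most `(q-1)/2`. So
`p ^ i c` reduces to at least `(q-1)/2`, each of the `d` floor differences is at least `1`, and the
exponent is at most `0`. -/
theorem not_smallDigits_neg_of_stickExp_pos (hp : 1 < p) (hodd : Odd p) (hd : 0 < d)
    (c : (ZMod (p ^ d - 1))ˣ) (hc : 0 < stickExp p d c) :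
    ¬ SmallDigits p d (-(c : ZMod (p ^ d - 1))) := by
  intro hsmall
  have hnz := neZero_pow_sub_one hp hd
  have hp3 : 3 ≤ p := by obtain ⟨h, rfl⟩ := hodd; omega
  have hpd : p ≤ p ^ d := Nat.le_self_pow hd.ne' p
  have : Fact (1 < p ^ d - 1) := ⟨by omega⟩
  have hcast : (p : ℚ) ^ d - 1 = ((p ^ d - 1 : ℕ) : ℚ) := by
    rw [Nat.cast_sub (by omega)]; push_cast; rfl
  have hlp : leastPos (c : ZMod (p ^ d - 1)) = (c : ZMod (p ^ d - 1)).val := by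
    unfold leastPos
    rw [if_neg (by rw [ZMod.val_eq_zero]; exact c.ne_zero)]
  have hp_unit : IsUnit ((p : ZMod (p ^ d - 1))) :=
    IsUnit.of_pow_eq_one (natCast_pow_eq_one (by omega)) hd.ne'
  have key : ∀ i ∈ Finset.range d, (1 : ℤ) ≤
      ⌊(2 * (leastPos (c : ZMod (p ^ d - 1)) : ℚ) * (p : ℚ) ^ i) / ((p : ℚ) ^ d - 1)⌋
      - 2 * ⌊((leastPos (c : ZMod (p ^ d - 1)) : ℚ) * (p : ℚ) ^ i) / ((p : ℚ) ^ d - 1)⌋ := by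
    intro i _
    have hle := (hsmall.pow_mul hp hd i).val_le hp hodd hd
    have hne : (p : ZMod (p ^ d - 1)) ^ i * (c : ZMod (p ^ d - 1)) ≠ 0 :=
      ((hp_unit.pow i).mul c.isUnit).ne_zero
    have : NeZero ((p : ZMod (p ^ d - 1)) ^ i * (c : ZMod (p ^ d - 1))) := ⟨hne⟩
    rw [mul_neg, ZMod.val_neg_of_ne_zero] at hle
    have hval : ((p : ZMod (p ^ d - 1)) ^ i * (c : ZMod (p ^ d - 1))).val =
        ((c : ZMod (p ^ d - 1)).val * p ^ i) % (p ^ d - 1) := by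
      rw [← ZMod.val_natCast]
      congr 1
      push_cast
      rw [ZMod.natCast_zmod_val, mul_comm]
    have h := two_mul_floor_add_one_le (N := (c : ZMod (p ^ d - 1)).val * p ^ i)
      (n := p ^ d - 1) (by omega) (by rw [← hval]; omega)
    rw [hlp, hcast, mul_assoc, mul_div_assoc]
    push_cast at h ⊢
    linarith
  have := Finset.card_nsmul_le_sum _ _ _ key
  rw [Finset.card_range, nsmul_eq_mul, mul_one] at this
  unfold stickExp at hc
  linarith

end Exponent

/-! ### Character sums of `S` with values in the field -/

section CharacterSum

variable {F : Type*} [Field F] {v : ℕ}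

/-- The value `α ^ x` for a residue `x` modulo `v`, where `α ^ v = 1`. -/
def resPow (α : Fˣ) (x : ZMod v) : F := (α : F) ^ x.val

/-- The character sum `∑_{s ∈ S} α ^ (a s)`. -/
def charSum (α : Fˣ) (S : Finset (ZMod v)) (a : ZMod v) : F := ∑ s ∈ S, resPow α (a * s)

theorem resPow_natCast {α : Fˣ} (hα : orderOf α = v) (k : ℕ) :
    resPow α (k : ZMod v) = (α : F) ^ k := by
  unfold resPow
  rw [ZMod.val_natCast, ← hα, ← orderOf_units, pow_mod_orderOf]

theorem resPow_add [NeZero v] {α : Fˣ} (hα : orderOf α = v) (x y : ZMod v) :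
    resPow α (x + y) = resPow α x * resPow α y := by
  conv_lhs => rw [← ZMod.natCast_zmod_val x, ← ZMod.natCast_zmod_val y, ← Nat.cast_add]
  rw [resPow_natCast hα, pow_add]
  rfl

theorem resPow_mul [NeZero v] {α : Fˣ} (hα : orderOf α = v) (a x : ZMod v) :
    resPow α (a * x) = resPow α x ^ a.val := by
  conv_lhs => rw [← ZMod.natCast_zmod_val x, ← ZMod.natCast_zmod_val a, ← Nat.cast_mul]
  rw [resPow_natCast hα, mul_comm, pow_mul]
  rfl

theorem resPow_eq_one_iff [NeZero v] {α : Fˣ} (hα : orderOf α = v) (x : ZMod v) :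
    resPow α x = 1 ↔ x = 0 := by
  unfold resPow
  rw [← orderOf_dvd_iff_pow_eq_one, orderOf_units, hα]
  constructor
  · intro h
    rw [← ZMod.natCast_zmod_val x, ZMod.natCast_eq_zero_iff]
    exact h
  · rintro rfl
    simp

/-- Extend `x ↦ α ^ (a x)` to a ring homomorphism on `ℤ[G]` and apply it to the multiplier identity;
`g` does not depend on `a`. -/
theorem charSum_mul_of_isMultiplier [NeZero v] {α : Fˣ} (hα : orderOf α = v)
    {S : Finset (ZMod v)} {t : (ZMod v)ˣ} (ht : IsMultiplier t (groupRingSum S)) :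
    ∃ g : ZMod v, ∀ a, charSum α S (a * t) = resPow α (a * g) * charSum α S a := by
  obtain ⟨g, hg⟩ := ht
  refine ⟨g, fun a => ?_⟩
  let χ : Multiplicative (ZMod v) →* F :=
    { toFun := fun x => resPow α (a * x.toAdd)
      map_one' := by simp [resPow]
      map_mul' := fun x y => by rw [toAdd_mul, mul_add, resPow_add hα] }
  have hχ : ∀ x : ZMod v, AddMonoidAlgebra.lift ℤ F (ZMod v) χ (AddMonoidAlgebra.single x 1) =
      resPow α (a * x) := fun x => by
    rw [AddMonoidAlgebra.lift_single, one_smul]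
    rfl
  have hpow : powMap t (groupRingSum S) =
      ∑ s ∈ S, AddMonoidAlgebra.single ((t : ZMod v) * s) 1 := by
    unfold powMap groupRingSum
    have hmap : ∀ A : Finset (ZMod v),
        AddMonoidAlgebra.mapDomain (fun g : ZMod v => leastPos (t : ZMod v) • g)
          (∑ s ∈ A, AddMonoidAlgebra.single s (1 : ℤ)) =
        ∑ s ∈ A, AddMonoidAlgebra.single ((t : ZMod v) * s) 1 := by
      classical
      intro A
      induction A using Finset.induction_on with
      | empty => simp
      | insert s A hs ih =>
        rw [Finset.sum_insert hs, Finset.sum_insert hs, AddMonoidAlgebra.mapDomain_add, ih,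
          AddMonoidAlgebra.mapDomain_single, nsmul_eq_mul,
          (isLeast_leastPos (NeZero.pos v) (t : ZMod v)).1.2]
    exact hmap S
  have h := congrArg (AddMonoidAlgebra.lift ℤ F (ZMod v) χ) hg
  rw [hpow, map_mul, hχ, map_sum] at h
  simp only [groupRingSum, map_sum, hχ] at h
  unfold charSum
  rw [← h]
  exact Finset.sum_congr rfl fun s _ => by rw [mul_assoc]

theorem mem_slceSet_iff [NeZero v] {α : Fˣ} (x : ZMod v) :
    x ∈ slceSet v α ↔ slceSeq α x.val = 1 := by
  unfold slceSet residueSet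
  simp only [Finset.mem_image, Finset.mem_filter, Finset.mem_range]
  constructor
  · rintro ⟨i, ⟨hi, h⟩, rfl⟩
    rwa [ZMod.val_cast_of_lt hi]
  · intro h
    exact ⟨x.val, ⟨x.val_lt, h⟩, ZMod.natCast_zmod_val x⟩

theorem pow_half_eq_neg_one {α : Fˣ} {m : ℕ} (hm : 0 < m) (hα : orderOf α = 2 * m) :
    (α : F) ^ m = -1 := by
  have h1 : ((α : F) ^ m) ^ 2 = 1 := by
    rw [← pow_mul, mul_comm, ← hα, ← orderOf_units, pow_orderOf_eq_one]
  refine (sq_eq_one_iff.1 h1).resolve_left fun h => ?_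
  have := Nat.le_of_dvd hm (orderOf_dvd_of_pow_eq_one h)
  rw [orderOf_units, hα] at this
  omega

variable [Fintype F]

theorem exists_pow_eq {α : Fˣ} (hα : orderOf α + 1 = Fintype.card F) {y : F} (hy : y ≠ 0) :
    ∃ k < orderOf α, (α : F) ^ k = y := by
  classical
  have htop : Subgroup.zpowers α = ⊤ := by
    rw [← Subgroup.card_eq_iff_eq_top, Nat.card_zpowers, Nat.card_eq_fintype_card,
      Fintype.card_units]
    omega
  have hmem : Units.mk0 y hy ∈ Subgroup.zpowers α := htop ▸ Subgroup.mem_top _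
  have hfin : IsOfFinOrder α := isOfFinOrder_of_finite α
  rw [← hfin.mem_powers_iff_mem_zpowers] at hmem
  obtain ⟨k, hk⟩ := hmem
  refine ⟨k % orderOf α, Nat.mod_lt _ hfin.orderOf_pos, ?_⟩
  rw [← Units.val_pow_eq_pow_val, pow_mod_orderOf]
  exact congrArg Units.val hk

/-- Euler's criterion: `α ^ j ∈ D_1` means that `1 + α ^ j` is an odd power of `α`, hence a
nonsquare. -/
theorem slceSeq_eq_one_iff {α : Fˣ} {m : ℕ} (hm : 0 < m) (hα : orderOf α = 2 * m)
    (hF : Fintype.card F = 2 * m + 1) (j : ℕ) :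
    slceSeq α j = 1 ↔ (1 + (α : F) ^ j) ^ m = -1 := by
  have hneg := pow_half_eq_neg_one hm hα
  have h1 : (1 : F) ≠ -1 := by
    intro h
    rw [← hneg] at h
    have := Nat.le_of_dvd hm (orderOf_dvd_of_pow_eq_one h.symm)
    rw [orderOf_units, hα] at this
    omega
  have hcard : (Nat.card F - 1) / 2 = m := by
    rw [Nat.card_eq_fintype_card, hF]; omega
  unfold slceSeq
  constructor
  · intro h
    split_ifs at h with h2 h3
    · simp at h
    · obtain ⟨i, -, hi⟩ := h3
      rw [hi, add_sub_cancel, ← pow_mul, add_mul, one_mul, pow_add, hneg,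
        show 2 * i * m = (2 * m) * i by ring, pow_mul, ← hα, ← orderOf_units, pow_orderOf_eq_one,
        one_pow, one_mul]
    · simp at h
  · intro h
    have h0 : 1 + (α : F) ^ j ≠ 0 := by
      intro h0
      rw [h0, zero_pow hm.ne'] at h
      exact one_ne_zero (neg_eq_zero.1 h.symm)
    rw [if_neg (fun hc => h0 (by rw [hc]; ring)), if_pos]
    obtain ⟨k, hk, hkj⟩ := exists_pow_eq (α := α) (by omega) h0
    have hkodd : Odd k := by
      by_contra hc
      rw [Nat.not_odd_iff_even] at hc
      obtain ⟨l, rfl⟩ := hc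
      rw [← hkj, ← pow_mul, mul_comm, pow_mul, hneg, ← two_mul, pow_mul, neg_one_sq, one_pow] at h
      exact h1 h
    obtain ⟨i, rfl⟩ := hkodd
    refine ⟨i, by omega, ?_⟩
    rw [hkj]; ring

/-- Expand `(1 + u) ^ m`. A power sum over the units vanishes unless `2 m` divides the exponent, and
`0 < a + k < 4 m` leaves only `a + k = 2 m`. -/
theorem sum_units_pow_mul_one_add_pow [DecidableEq F] {m a : ℕ}
    (hF : Fintype.card F = 2 * m + 1) (ha : 0 < a) (hav : a < 2 * m) :
    ∑ u : Fˣ, (u : F) ^ a * (1 + (u : F)) ^ m = -(m.choose (2 * m - a) : F) := by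
  have h1 : ∀ u : Fˣ, (u : F) ^ a * (1 + (u : F)) ^ m =
      ∑ k ∈ Finset.range (m + 1), (m.choose k : F) * (u : F) ^ (a + k) := by
    intro u
    rw [add_comm 1, add_pow, Finset.mul_sum]
    refine Finset.sum_congr rfl fun k _ => ?_
    rw [one_pow, pow_add]; ring
  simp only [h1]
  rw [Finset.sum_comm]
  simp only [← Finset.mul_sum, FiniteField.sum_pow_units, hF, Nat.add_sub_cancel]
  rw [Finset.sum_eq_single (2 * m - a)]
  · rw [if_pos (by rw [Nat.add_sub_cancel' hav.le])]; ring
  · intro k hk hne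
    rw [Finset.mem_range] at hk
    rw [if_neg, mul_zero]
    rintro ⟨c, hc⟩
    have hc1 : c = 1 := by
      have : c ≠ 0 := by rintro rfl; omega
      have : c < 2 := by by_contra h; have := Nat.mul_le_mul_left (2 * m) (show 2 ≤ c by omega); omega
      omega
    subst hc1
    omega
  · intro h
    rw [Finset.mem_range] at h
    rw [Nat.choose_eq_zero_of_lt (by omega), Nat.cast_zero, zero_mul]

/-- The character sums of the SLCE almost difference set over the finite field itself. -/
theorem two_mul_charSum_slceSet [NeZero v] {α : Fˣ} {m : ℕ} (hm : 0 < m) (hv : v = 2 * m)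
    (hα : orderOf α = v) (hF : Fintype.card F = 2 * m + 1) {a : ZMod v} (ha : a ≠ 0) :
    2 * charSum α (slceSet v α) a = (m.choose (-a).val : F) - resPow α (a * (m : ZMod v)) := by
  classical
  have hα2 : orderOf α = 2 * m := hα.trans hv
  have hneg := pow_half_eq_neg_one hm hα2
  have h1 : (1 : F) ≠ -1 := by
    intro h
    rw [← hneg] at h
    have := Nat.le_of_dvd hm (orderOf_dvd_of_pow_eq_one h.symm)
    rw [orderOf_units, hα2] at this
    omega
  have hsq : ∀ y : F, y ≠ 0 → y ^ m = 1 ∨ y ^ m = -1 := by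
    intro y hy
    rw [← sq_eq_one_iff, ← pow_mul, mul_comm, show 2 * m = Fintype.card F - 1 by omega]
    exact FiniteField.pow_card_sub_one_eq_one y hy
  have hapos : 0 < a.val := Nat.pos_of_ne_zero fun h => ha ((ZMod.val_eq_zero a).1 h)
  have halt := a.val_lt
  -- Twice the indicator of `S` is `1 - (1 + α ^ x) ^ m`, corrected at `α ^ x = -1`, where the
  -- quadratic character is `0`.
  have hind : ∀ x : ZMod v, (2 * if x ∈ slceSet v α then resPow α (a * x) else 0) =
      ((resPow α x) ^ a.val - (resPow α x) ^ a.val * (1 + resPow α x) ^ m) -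
        if resPow α x = -1 then (resPow α x) ^ a.val else 0 := by
    intro x
    simp only [mem_slceSet_iff, slceSeq_eq_one_iff hm hα2 hF, resPow_mul hα]
    simp only [show (α : F) ^ x.val = resPow α x from rfl]
    by_cases h0 : resPow α x = -1
    · rw [if_pos h0, h0, add_neg_cancel, zero_pow hm.ne', if_neg]
      · ring
      · exact fun h => one_ne_zero (neg_eq_zero.1 h.symm)
    · rw [if_neg h0]
      rcases hsq (1 + resPow α x) (fun h => h0 (by linear_combination h)) with h2 | h2
      · rw [h2, if_neg h1]; ring
      · rw [h2, if_pos rfl]; ring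
  have hbij : Function.Bijective (fun x : ZMod v => α ^ x.val) := by
    rw [Fintype.bijective_iff_injective_and_card]
    constructor
    · intro x y hxy
      refine ZMod.val_injective v (pow_injOn_Iio_orderOf ?_ ?_ hxy)
      · rw [hα]; exact x.val_lt
      · rw [hα]; exact y.val_lt
    · rw [ZMod.card, Fintype.card_units, hF, hv]; rfl
  have hsum := hbij.sum_comp (fun u : Fˣ => ((u : F) ^ a.val - (u : F) ^ a.val * (1 + (u : F)) ^ m)
    - if (u : F) = -1 then (u : F) ^ a.val else 0)
  simp only [Units.val_pow_eq_pow_val] at hsum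
  have hlhs : 2 * charSum α (slceSet v α) a = ∑ x : ZMod v,
      (2 * if x ∈ slceSet v α then resPow α (a * x) else 0) := by
    rw [← Finset.mul_sum, charSum, Finset.sum_ite_mem, Finset.univ_inter]
  rw [hlhs, Finset.sum_congr rfl fun x _ => hind x]
  refine hsum.trans ?_
  rw [Finset.sum_sub_distrib, Finset.sum_sub_distrib, FiniteField.sum_pow_units,
    sum_units_pow_mul_one_add_pow hF hapos (by omega), if_neg]
  · have hm1 : ∑ u : Fˣ, (if (u : F) = -1 then (u : F) ^ a.val else 0) = (-1) ^ a.val := by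
      rw [Finset.sum_eq_single (-1 : Fˣ)]
      · simp
      · intro u _ hu
        rw [if_neg]
        intro h
        exact hu (Units.ext (by simpa using h))
      · simp
    have : NeZero a := ⟨ha⟩
    rw [hm1, resPow_mul hα, resPow_natCast hα, hneg, ZMod.val_neg_of_ne_zero,
      show 2 * m - a.val = v - a.val by rw [← hv]]
    ring
  · rw [hF]
    intro h
    have := Nat.le_of_dvd hapos h
    omega

end CharacterSum

/-- Units modulo `2 m` are odd. This fixes the sign `α ^ (a m)` under `a ↦ a t`. -/
theorem natCast_mul_unit_eq {v m : ℕ} (hm : 0 < m) (hv : v = 2 * m) (t : (ZMod v)ˣ) :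
    (t : ZMod v) * (m : ZMod v) = m := by
  have : NeZero v := ⟨by omega⟩
  have hcop : (t : ZMod v).val.Coprime (2 * m) := hv ▸ ZMod.val_coe_unit_coprime t
  obtain ⟨k, hk⟩ : Odd (t : ZMod v).val :=
    Nat.coprime_two_right.1 (Nat.Coprime.coprime_mul_right_right hcop)
  have h0 : ((2 * m : ℕ) : ZMod v) = 0 := by rw [← hv]; exact ZMod.natCast_self v
  rw [← ZMod.natCast_zmod_val (t : ZMod v), hk]
  push_cast at h0 ⊢
  linear_combination (k : ZMod v) * h0

/-! ### Multipliers and the subgroup `⟨p⟩` -/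

section

variable {p d : ℕ}

theorem mem_genSubgroup_of_eq_pow {k : ℕ} (hp : 0 < p) {t : (ZMod (p ^ d - 1))ˣ} (hd : 0 < d)
    (h : (t : ZMod (p ^ d - 1)) = (p : ZMod (p ^ d - 1)) ^ k) :
    t ∈ genSubgroup (p ^ d - 1) p := by
  obtain ⟨u, hu⟩ := IsUnit.of_pow_eq_one (natCast_pow_eq_one (p := p) hp) hd.ne'
  have : t = u ^ k := Units.ext (by rw [h, Units.val_pow_eq_pow_val, hu])
  rw [this]
  have hmem : u ∈ genSubgroup (p ^ d - 1) p := Subgroup.subset_closure (by exact hu)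
  exact pow_mem hmem k

theorem exists_eq_pow_of_mem_genSubgroup (hp : 1 < p) (hd : 0 < d) {t : (ZMod (p ^ d - 1))ˣ}
    (h : t ∈ genSubgroup (p ^ d - 1) p) :
    ∃ k : ℕ, (t : ZMod (p ^ d - 1)) = (p : ZMod (p ^ d - 1)) ^ k := by
  have := neZero_pow_sub_one hp hd
  obtain ⟨u, hu⟩ := IsUnit.of_pow_eq_one (natCast_pow_eq_one (p := p) (by omega)) hd.ne'
  have hcop : p.Coprime (p ^ d - 1) := (ZMod.isUnit_iff_coprime p _).1 (hu ▸ u.isUnit)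
  rw [genSubgroup_eq_zpowers hcop, ← (isOfFinOrder_of_finite (ZMod.unitOfCoprime p hcop)).mem_powers_iff_mem_zpowers] at h
  obtain ⟨k, rfl⟩ := h
  exact ⟨k, by simp⟩

/-- As `p ^ d = 1`, a further factor `p ^ (k (d - 1))` undoes the rotation. -/
theorem SmallDigits.of_pow_mul (hp : 1 < p) (hd : 0 < d) {e : ZMod (p ^ d - 1)} {k : ℕ}
    (h : SmallDigits p d ((p : ZMod (p ^ d - 1)) ^ k * e)) : SmallDigits p d e := by
  have h1 := h.pow_mul hp hd (k * (d - 1))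
  rwa [← mul_assoc, ← pow_add, show k * (d - 1) + k = d * k by
    obtain ⟨c, rfl⟩ := Nat.exists_eq_succ_of_ne_zero hd.ne'; simp; ring, _root_.pow_mul,
    natCast_pow_eq_one (by omega), one_pow, one_mul] at h1

/-- A multiplier for which the residues with positive exponent and their translates share a coset
of `⟨p⟩` lies in `⟨p⟩`. -/
theorem mem_genSubgroup_of_isMultiplier (hp : p.Prime) (hodd : Odd p) (hd : 0 < d)
    {F : Type*} [Field F] [Finite F] (hF : Nat.card F = p ^ d) {α : Fˣ}
    (hα : ∀ x : Fˣ, x ∈ Subgroup.zpowers α) {t : (ZMod (p ^ d - 1))ˣ}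
    (ht : IsMultiplier t (groupRingSum (slceSet (p ^ d - 1) α)))
    {i j : (ZMod (p ^ d - 1))ˣ} (hi : 0 < stickExp p d i⁻¹) (hj : 0 < stickExp p d j⁻¹)
    (hij : i⁻¹ * (t * j) ∈ genSubgroup (p ^ d - 1) p) : t ∈ genSubgroup (p ^ d - 1) p := by
  have := Fintype.ofFinite F
  have hnz := neZero_pow_sub_one hp.one_lt hd
  have hp3 : 3 ≤ p := by have := hp.two_le; obtain ⟨h, rfl⟩ := hodd; omega
  have hpd : p ≤ p ^ d := Nat.le_self_pow hd.ne' p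
  have : Fact (1 < p ^ d - 1) := ⟨by omega⟩
  have hcard : Fintype.card F = p ^ d := by rw [← Nat.card_eq_fintype_card, hF]
  have hpFact : Fact p.Prime := ⟨hp⟩
  have hchar : CharP F p := charP_of_card_eq_prime_pow hcard
  set m := (p ^ d - 1) / 2 with hmdef
  have hodd' : Odd (p ^ d) := hodd.pow
  have hv : p ^ d - 1 = 2 * m := by obtain ⟨c, hc⟩ := hodd'; omega
  have hm : 0 < m := by omega
  have hF2 : Fintype.card F = 2 * m + 1 := by omega
  have hord : orderOf α = p ^ d - 1 := by
    classical
    rw [orderOf_eq_card_of_forall_mem_zpowers hα, Nat.card_eq_fintype_card, Fintype.card_units,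
      hcard]
  have hneg : resPow α (m : ZMod (p ^ d - 1)) = -1 := by
    rw [resPow_natCast hord]
    exact pow_half_eq_neg_one hm (hord.trans hv)
  have hS : ∀ a : ZMod (p ^ d - 1), a ≠ 0 → 2 * charSum α (slceSet (p ^ d - 1) α) a =
      (m.choose (-a).val : F) - resPow α (a * (m : ZMod (p ^ d - 1))) :=
    fun a ha => two_mul_charSum_slceSet hm hv hord hF2 ha
  have hone : ∀ c : (ZMod (p ^ d - 1))ˣ, ¬ SmallDigits p d (-(c : ZMod (p ^ d - 1))) →
      2 * charSum α (slceSet (p ^ d - 1) α) (c : ZMod (p ^ d - 1)) = 1 := by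
    intro c hc
    rw [← choose_half_ne_zero_iff hp hodd hd F, not_not] at hc
    rw [hS _ c.ne_zero, hc, natCast_mul_unit_eq hm hv, hneg]
    ring
  obtain ⟨g, hg⟩ := charSum_mul_of_isMultiplier hord ht
  have hi' := not_smallDigits_neg_of_stickExp_pos hp.one_lt hodd hd _ hi
  have hj' := not_smallDigits_neg_of_stickExp_pos hp.one_lt hodd hd _ hj
  obtain ⟨k, hk⟩ := exists_eq_pow_of_mem_genSubgroup hp.one_lt hd hij
  have hit : ¬ SmallDigits p d (-((i⁻¹ * t : (ZMod (p ^ d - 1))ˣ) : ZMod (p ^ d - 1))) := by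
    intro h
    apply hj'
    have h1 : ((i⁻¹ * t : (ZMod (p ^ d - 1))ˣ) : ZMod (p ^ d - 1)) =
        (p : ZMod (p ^ d - 1)) ^ k * ((j⁻¹ : (ZMod (p ^ d - 1))ˣ) : ZMod (p ^ d - 1)) := by
      rw [← hk, ← Units.val_mul, ← mul_assoc, mul_inv_cancel_right]
    rw [h1, ← mul_neg] at h
    exact h.of_pow_mul hp.one_lt hd
  -- Twice the sum is `1` at both `i⁻¹` and `i⁻¹ t`, so `α ^ (i⁻¹ g) = 1`.
  have hg0 : g = 0 := by
    have h1 := hone _ hi'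
    have h2 := hone _ hit
    rw [Units.val_mul, hg, mul_left_comm, h1, mul_one, resPow_eq_one_iff hord] at h2
    exact (Units.mul_right_eq_zero _).1 h2
  have hinv : ∀ e : ZMod (p ^ d - 1), SmallDigits p d e → SmallDigits p d (t * e) := by
    intro e he
    by_cases h0 : e = 0
    · rw [h0, mul_zero]; exact smallDigits_zero
    -- With `g = 0` the sums at `-e t` and `-e` agree, as do their sign terms, hence so do the
    -- binomials.
    have h1 := hS (-e * t) (by simpa using h0)
    rw [hg, hg0, mul_zero, (resPow_eq_one_iff hord 0).2 rfl, one_mul, hS _ (neg_ne_zero.2 h0),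
      mul_assoc, natCast_mul_unit_eq hm hv, sub_left_inj, neg_mul, neg_neg, neg_neg] at h1
    rw [← choose_half_ne_zero_iff hp hodd hd F] at he ⊢
    rwa [mul_comm, ← h1]
  obtain ⟨l, hl⟩ := exists_eq_pow_of_smallDigits_mul hp.one_lt hodd hd t hinv
  exact mem_genSubgroup_of_eq_pow hp.pos hd hl

end

end SLCE

theorem mainTheorem2 (p d : ℕ) (hp : p.Prime) (hodd : Odd p) (hd : 0 < d)
    (F : Type*) [Field F] [Finite F] (hF : Nat.card F = p ^ d)
    (α : Fˣ) (hα : ∀ x : Fˣ, x ∈ Subgroup.zpowers α)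
    (T : Set (ZMod (p ^ d - 1))ˣ)
    (hT : Subgroup.IsComplement T (SLCE.genSubgroup (p ^ d - 1) p : Set (ZMod (p ^ d - 1))ˣ))
    (t : (ZMod (p ^ d - 1))ˣ) (htT : t ∈ T)
    (ht : SLCE.IsMultiplier t (SLCE.groupRingSum (SLCE.slceSet (p ^ d - 1) α))) :
    (SLCE.S0 p d T = t • SLCE.S0 p d T ∨ Disjoint (SLCE.S0 p d T) (t • SLCE.S0 p d T)) ∧
    (SLCE.cosets p (SLCE.S0 p d T) = SLCE.cosets p (t • SLCE.S0 p d T) ∨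
      Disjoint (SLCE.cosets p (SLCE.S0 p d T)) (SLCE.cosets p (t • SLCE.S0 p d T))) := by
  by_cases htp : t ∈ SLCE.genSubgroup (p ^ d - 1) p
  · constructor
    · by_cases ht1 : t = 1
      · left; rw [ht1, one_smul]
      · right
        rw [Set.disjoint_left]
        rintro _ hi ⟨j, hj, rfl⟩
        -- `t j` and `j` are representatives in `T` of one coset, hence equal.
        have h := @hT.1 (⟨t * j, hi.1⟩, ⟨1, Subgroup.one_mem _⟩) (⟨j, hj.1⟩, ⟨t, htp⟩)
          (by simp [mul_comm])
        have h1 : t * j = j := congrArg (fun x => (x.1 : (ZMod (p ^ d - 1))ˣ)) h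
        exact ht1 (mul_eq_right.1 h1)
    · left
      have h : ∀ j : (ZMod (p ^ d - 1))ˣ,
          ((t * j : (ZMod (p ^ d - 1))ˣ) :
            (ZMod (p ^ d - 1))ˣ ⧸ SLCE.genSubgroup (p ^ d - 1) p) = j := by
        intro j
        rw [mul_comm]
        exact QuotientGroup.mk_mul_of_mem j htp
      unfold SLCE.cosets
      rw [← Set.image_smul, Set.image_image]
      simp only [smul_eq_mul, h]
  · have hdisj : Disjoint (SLCE.cosets p (SLCE.S0 p d T))
        (SLCE.cosets p (t • SLCE.S0 p d T)) := by
      rw [Set.disjoint_left]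
      rintro _ ⟨i, hi, rfl⟩ ⟨_, ⟨j, hj, rfl⟩, hij⟩
      exact htp (SLCE.mem_genSubgroup_of_isMultiplier hp hodd hd hF hα ht hi.2 hj.2
        (QuotientGroup.eq.1 hij.symm))
    exact ⟨Or.inr (Disjoint.of_image hdisj), Or.inr hdisj⟩
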